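/- Let $T>0$, $H\in(1/2,1)$, and let $(B^H_t)_{t\in[0,T]}$ be a fractional Brownian motion with Hurst parameter $H$ on a probability space, i.e. a centered Gaussian process with almost surely continuous paths and covariance $\mathbb{E}[B^H_tB^H_s]=\frac12\big(t^{2H}+s^{2H}-|t-s|^{2H}\big)$. Let $b\colon\mathbb{R}\to\mathbb{R}$ be measurable, let $\sigma\colon\mathbb{R}\to\mathbb{R}$ be globally Lipschitz continuous, let $x_0\in\mathbb{R}$ be deterministic, and let $(X_t)_{t\in[0,T]}$ be a solution of $$X_t=x_0+\int_0^t b(X_s)\,ds+\int_0^t\sigma(X_s)\,dB^H_s,\qquad t\in[0,T],$$ that is, almost surely, for all $t\in[0,T]$, the first integral converges absolutely as a Lebesgue integral, the second exists as a pathwise Riemann--Stieltjes integral, and the equation holds. Assume that for every $\gamma\in(0,H)$ the paths of $X$ are almost surely $\gamma$-Hölder continuous on $[0,T]$, and that for every $t\in(0,T]$ the law of $X_t$ has a density $p_t$ such that the function $t\mapsto\sup_{y\in\mathbb{R}}p_t(y)$ belongs to $L^1([0,T])$. Then for every $x\in\mathbb{R}$, almost surely, for all $t\in[0,T]$, $$|X_t-x|=|X_0-x|+\int_0^t\operatorname{sgn}(X_s-x)\,b(X_s)\,ds+\int_0^t\operatorname{sgn}(X_s-x)\,\sigma(X_s)\,dB^H_s,$$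 where $\operatorname{sgn}(0)=0$, the first integral converges absolutely, and the second exists as a pathwise Riemann--Stieltjes integral: for almost every $\omega$, the Riemann--Stieltjes sums over partitions of $[0,t]$ with arbitrary intermediate points converge to it as the mesh tends to zero. -/

import Mathlib

open MeasureTheory ProbabilityTheory Set
open scoped NNReal ENNReal

/-- `HasRSIntegral f g a b I`: the Riemann-Stieltjes integral of `f` with respect to `g` over
`[a, b]` exists and equals `I`, i.e. the tagged Riemann-Stieltjes sums over all partitions
`a = t 0 ≤ t 1 ≤ ⋯ ≤ t n = b` with arbitrary tags `ξ i ∈ [t i, t (i + 1)]` converge to `I` as the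
mesh of the partition tends to zero. -/
def HasRSIntegral (f g : ℝ → ℝ) (a b I : ℝ) : Prop :=
  a ≤ b ∧ ∀ ε : ℝ, 0 < ε → ∃ δ : ℝ, 0 < δ ∧
    ∀ (n : ℕ) (t ξ : ℕ → ℝ), t 0 = a → t n = b →
      (∀ i < n, ξ i ∈ Icc (t i) (t (i + 1)) ∧ t (i + 1) - t i < δ) →
      |∑ i ∈ Finset.range n, f (ξ i) * (g (t (i + 1)) - g (t i)) - I| < ε

/-- `(B t)` for `t ∈ [0, T]` is a fractional Brownian motion with Hurst parameter `H`: a centered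
Gaussian process with covariance `(t ^ (2H) + s ^ (2H) - |t - s| ^ (2H)) / 2` and almost surely
continuous paths. Only the times in `[0, T]` matter. -/
structure IsFractionalBrownianMotion {Ω : Type*} [MeasurableSpace Ω] (μ : Measure Ω)
    (H T : ℝ) (B : ℝ → Ω → ℝ) : Prop where
  gaussian : IsGaussianProcess (fun t : Icc (0 : ℝ) T => B (t : ℝ)) μ
  centered : ∀ t ∈ Icc (0 : ℝ) T, ∫ ω, B t ω ∂μ = 0
  covariance_eq : ∀ s ∈ Icc (0 : ℝ) T, ∀ t ∈ Icc (0 : ℝ) T,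
    covariance (B s) (B t) μ = (t ^ (2 * H) + s ^ (2 * H) - |t - s| ^ (2 * H)) / 2
  continuous_paths : ∀ᵐ ω ∂μ, ContinuousOn (fun t => B t ω) (Icc 0 T)

/-- `(X t)` for `t ∈ [0, T]` is a solution of `dX = b(X) dt + σ(X) dB`, `X 0 = x₀`: each `X t` is
a random variable and, almost surely, for all `t ∈ [0, T]`,
`X t = x₀ + ∫_0^t b(X s) ds + ∫_0^t σ(X s) dB s`, where the drift integral is an absolutely
convergent Lebesgue integral and the integral against `B` is a pathwise Riemann-Stieltjes
integral. -/
structure IsPathwiseSDESolution {Ω : Type*} [MeasurableSpace Ω] (μ : Measure Ω)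
    (T : ℝ) (B : ℝ → Ω → ℝ) (b σ : ℝ → ℝ) (x₀ : ℝ) (X : ℝ → Ω → ℝ) : Prop where
  measurable : ∀ t ∈ Icc (0 : ℝ) T, Measurable (X t)
  equation : ∀ᵐ ω ∂μ, ∀ t ∈ Icc (0 : ℝ) T,
    IntervalIntegrable (fun s => b (X s ω)) volume 0 t ∧
    ∃ J : ℝ, HasRSIntegral (fun s => σ (X s ω)) (fun s => B s ω) 0 t J ∧
      X t ω = x₀ + (∫ s in (0 : ℝ)..t, b (X s ω)) + J

open Filter Topology

/-! The argument is pathwise, with Y = X - x. Fix γ in (1/2, H) and compare a tagged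
Riemann-Stieltjes sum of sgn(Y) σ(X) against B with the telescoping sum of |Y| minus its drift, cell
by cell. On a cell of length h where Y has no zero, the sign is constant and the Young-Love estimate
gives an error O(h^(2γ)); since 2γ > 1 these sum to something vanishing with the mesh.

On a cell containing a zero the error is only O(h^γ) plus drift, and such terms need not sum to
something small by themselves. But there |Y| ≤ C h^γ throughout, so with θ = (1 - γ)/γ the error h^γ
is at most a constant times ∫ |Y|^(-θ) over the cell. The bad cells lie in {|Y| ≤ C δ^γ}, where δ
bounds the mesh, and dominated convergence applies once |Y|^(-θ) is integrable in time
(`hasRSIntegral_sign_mul`).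

Probability enters twice: B is γ-Hölder by Kolmogorov's moment argument
(`IsFractionalBrownianMotion.ae_exists_holder`), and since θ < 1 the density bound makes ∫ E|X_t -
x|^(-θ) dt finite (`ae_lintegral_enorm_sub_rpow_neg_lt_top`). -/

/-! ### Riemann-Stieltjes integrals and the Young-Love estimate -/

/-- Riemann-Stieltjes integrals over two intervals with common left end point `a` yield, by
subtraction, the integral over the difference. -/
lemma HasRSIntegral.sub {f g : ℝ → ℝ} {a b c I J : ℝ} (hI : HasRSIntegral f g a b I)
    (hJ : HasRSIntegral f g a c J) (hbc : b ≤ c) : HasRSIntegral f g b c (J - I) := by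
  refine ⟨hbc, fun ε hε => ?_⟩
  obtain ⟨δ₁, hδ₁, h₁⟩ := hI.2 (ε / 2) (half_pos hε)
  obtain ⟨δ₂, hδ₂, h₂⟩ := hJ.2 (ε / 2) (half_pos hε)
  refine ⟨δ₂, hδ₂, fun n t ξ ht0 htn ht => ?_⟩
  have hab : 0 ≤ b - a := sub_nonneg.2 hI.1
  have hδ : 0 < min δ₁ δ₂ := lt_min hδ₁ hδ₂
  -- A partition of [b, c] is prolonged to the left by `m` equal cells of [a, b], fine enough for
  -- both integrals. The strict inequality keeps `m` positive even when a = b.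
  obtain ⟨m, hm⟩ := exists_nat_gt ((b - a) / min δ₁ δ₂)
  have hm0 : (0 : ℝ) < m := lt_of_le_of_lt (div_nonneg hab hδ.le) hm
  have hmesh : (b - a) / m < min δ₁ δ₂ := by
    rw [div_lt_iff₀ hδ] at hm
    rw [div_lt_iff₀ hm0]
    linarith
  have hstep : 0 ≤ (b - a) / m := div_nonneg hab hm0.le
  set u : ℕ → ℝ := fun i => a + i * ((b - a) / m) with hu
  have husucc : ∀ i, u (i + 1) - u i = (b - a) / m := fun i => by
    simp only [hu]; push_cast; ring
  have hum : u m = b := by simp only [hu]; field_simp; ring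
  have hA : ∀ i < m, u i ∈ Icc (u i) (u (i + 1)) ∧ u (i + 1) - u i < min δ₁ δ₂ := fun i _ =>
    ⟨⟨le_rfl, by linarith [husucc i]⟩, by rw [husucc]; exact hmesh⟩
  have e₁ := h₁ m u u (by simp [hu]) hum
    fun i hi => ⟨(hA i hi).1, (hA i hi).2.trans_le (min_le_left _ _)⟩
  set v : ℕ → ℝ := fun i => if i < m then u i else t (i - m) with hv
  set η : ℕ → ℝ := fun i => if i < m then u i else ξ (i - m) with hη
  have hvl : ∀ i ≤ m, v i = u i := fun i hi => by
    rcases hi.lt_or_eq with h | rfl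
    · simp [hv, h]
    · simp [hv, hum, ht0]
  have hvr : ∀ i, v (m + i) = t i := fun i => by simp [hv]
  have hηl : ∀ i < m, η i = u i := fun i hi => by simp [hη, hi]
  have hηr : ∀ i, η (m + i) = ξ i := fun i => by simp [hη]
  have e₂ := h₂ (m + n) v η (by rw [hvl 0 (Nat.zero_le _)]; simp [hu]) (by rw [hvr, htn]) <| by
    intro i hi
    rcases lt_or_ge i m with h | h
    · rw [hvl i h.le, hvl (i + 1) h, hηl i h]
      exact ⟨(hA i h).1, (hA i h).2.trans_le (min_le_right _ _)⟩
    · obtain ⟨k, rfl⟩ := Nat.exists_eq_add_of_le h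
      rw [add_assoc, hvr, hvr, hηr]
      exact ht k (by omega)
  rw [Finset.sum_range_add] at e₂
  have s₁ : ∑ i ∈ Finset.range m, f (η i) * (g (v (i + 1)) - g (v i))
      = ∑ i ∈ Finset.range m, f (u i) * (g (u (i + 1)) - g (u i)) :=
    Finset.sum_congr rfl fun i hi => by
      have h := Finset.mem_range.1 hi
      rw [hvl i h.le, hvl (i + 1) h, hηl i h]
  have s₂ : ∑ i ∈ Finset.range n, f (η (m + i)) * (g (v (m + i + 1)) - g (v (m + i)))
      = ∑ i ∈ Finset.range n, f (ξ i) * (g (t (i + 1)) - g (t i)) :=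
    Finset.sum_congr rfl fun i _ => by rw [add_assoc, hvr, hvr, hηr]
  rw [s₁, s₂] at e₂
  rw [abs_lt] at *
  constructor <;> linarith

lemma sum_range_two_mul (f : ℕ → ℝ) (m : ℕ) :
    ∑ i ∈ Finset.range (2 * m), f i = ∑ i ∈ Finset.range m, (f (2 * i) + f (2 * i + 1)) := by
  induction m with
  | zero => simp
  | succ k ih =>
    rw [show 2 * (k + 1) = 2 * k + 1 + 1 by ring, Finset.sum_range_succ, Finset.sum_range_succ, ih,
      Finset.sum_range_succ]
    ring

lemma div_two_pow_rpow {h γ : ℝ} (hh : 0 ≤ h) (n : ℕ) :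
    (h / 2 ^ n) ^ γ = h ^ γ * ((2 : ℝ) ^ (-γ)) ^ n := by
  rw [Real.div_rpow hh (by positivity), div_eq_mul_inv, ← Real.rpow_natCast 2 n,
    ← Real.rpow_natCast ((2 : ℝ) ^ (-γ)) n, ← Real.rpow_mul two_pos.le, ← Real.rpow_mul two_pos.le,
    ← Real.rpow_neg two_pos.le]
  ring_nf

/-- The ratio of the Young-Love series: each dyadic refinement doubles the number of cells and
scales a product of two γ-Hölder increments by 2^(-2γ). -/
lemma two_mul_two_rpow_neg_sq_lt_one {γ : ℝ} (hγ : 1 / 2 < γ) :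
    2 * ((2 : ℝ) ^ (-γ)) ^ 2 < 1 := by
  have h1 : ((2 : ℝ) ^ (-γ)) ^ 2 = (2 : ℝ) ^ (-(2 * γ)) := by
    rw [← Real.rpow_natCast, ← Real.rpow_mul two_pos.le]; congr 1; push_cast; ring
  have h2 : (2 : ℝ) ^ (-(2 * γ)) < 2 ^ (-1 : ℝ) :=
    Real.rpow_lt_rpow_of_exponent_lt (by norm_num) (by linarith)
  rw [Real.rpow_neg_one] at h2
  rw [h1]
  linarith

/-- The Young-Love estimate for a Riemann-Stieltjes integral known to exist. -/
lemma HasRSIntegral.abs_sub_le_of_holder {u g : ℝ → ℝ} {a b J γ Cu Cg : ℝ} (hγ : 1 / 2 < γ)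
    (hJ : HasRSIntegral u g a b J) (hCu : 0 ≤ Cu) (hCg : 0 ≤ Cg)
    (hu : ∀ s ∈ Icc a b, ∀ t ∈ Icc a b, |u s - u t| ≤ Cu * |s - t| ^ γ)
    (hg : ∀ s ∈ Icc a b, ∀ t ∈ Icc a b, |g s - g t| ≤ Cg * |s - t| ^ γ) :
    |J - u a * (g b - g a)|
      ≤ Cu * Cg / (1 - 2 * ((2 : ℝ) ^ (-γ)) ^ 2) * ((b - a) ^ γ) ^ 2 := by
  set q : ℝ := (2 : ℝ) ^ (-γ) with hq
  have hq0 : 0 < q := by positivity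
  have hq1 : q ≤ 1 := Real.rpow_le_one_of_one_le_of_nonpos (by norm_num) (by linarith)
  have hr : 2 * q ^ 2 < 1 := two_mul_two_rpow_neg_sq_lt_one hγ
  set h : ℝ := b - a with hh
  have hh0 : 0 ≤ h := sub_nonneg.2 hJ.1
  set P : ℕ → ℕ → ℝ := fun n i => a + i * (h / 2 ^ n) with hP
  have hPsucc : ∀ n i, P n (i + 1) - P n i = h / 2 ^ n := fun n i => by
    simp only [hP]; push_cast; ring
  have hPeven : ∀ n i, P (n + 1) (2 * i) = P n i := fun n i => by
    simp only [hP]; push_cast; field_simp; ring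
  have hPend : ∀ n, P n (2 ^ n) = b := fun n => by
    simp only [hP, hh]; push_cast; field_simp; ring
  have hPmem : ∀ n i, i ≤ 2 ^ n → P n i ∈ Icc a b := fun n i hi => by
    have h1 : 0 ≤ h / 2 ^ n := by positivity
    have h2 : (i : ℝ) ≤ 2 ^ n := by exact_mod_cast hi
    refine ⟨by simp only [hP]; linarith [mul_nonneg (Nat.cast_nonneg (α := ℝ) i) h1], ?_⟩
    rw [← hPend n]
    simp only [hP]
    gcongr
  set S : ℕ → ℝ := fun n => ∑ i ∈ Finset.range (2 ^ n), u (P n i) * (g (P n (i + 1)) - g (P n i))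
    with hS
  have hlim : Tendsto S atTop (𝓝 J) := by
    rw [Metric.tendsto_atTop]
    intro ε hε
    obtain ⟨δ, hδ, hδ'⟩ := hJ.2 ε hε
    have : Tendsto (fun n : ℕ => h * (1 / 2 : ℝ) ^ n) atTop (𝓝 (h * 0)) :=
      (tendsto_pow_atTop_nhds_zero_of_lt_one (by norm_num) (by norm_num)).const_mul h
    rw [mul_zero] at this
    obtain ⟨N, hN⟩ := eventually_atTop.1 (this.eventually (gt_mem_nhds hδ))
    refine ⟨N, fun n hn => ?_⟩
    refine hδ' (2 ^ n) (P n) (P n) (by simp [hP]) (hPend n) fun i _ => ⟨⟨le_rfl, ?_⟩, ?_⟩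
    · have : 0 ≤ h / 2 ^ n := by positivity
      linarith [hPsucc n i]
    · rw [hPsucc]
      have := hN n hn
      rwa [one_div, inv_pow, ← div_eq_mul_inv] at this
  have hdist : ∀ n, dist (S n) (S (n + 1)) ≤ Cu * Cg * (h ^ γ) ^ 2 * (2 * q ^ 2) ^ n := by
    intro n
    -- Inserting a midpoint alters the sum only by the product of an increment of `u` over the left
    -- half and one of `g` over the right half.
    have e : S n - S (n + 1) = ∑ i ∈ Finset.range (2 ^ n),
        (u (P (n + 1) (2 * i)) - u (P (n + 1) (2 * i + 1))) *
          (g (P (n + 1) (2 * i + 2)) - g (P (n + 1) (2 * i + 1))) := by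
      simp only [hS]
      rw [pow_succ' 2 n, sum_range_two_mul, ← Finset.sum_sub_distrib]
      refine Finset.sum_congr rfl fun i _ => ?_
      rw [← hPeven n i, ← hPeven n (i + 1), show 2 * (i + 1) = 2 * i + 2 by ring]
      ring
    rw [Real.dist_eq, e]
    refine (Finset.abs_sum_le_sum_abs _ _).trans ?_
    have hterm : ∀ i ∈ Finset.range (2 ^ n),
        |(u (P (n + 1) (2 * i)) - u (P (n + 1) (2 * i + 1))) *
          (g (P (n + 1) (2 * i + 2)) - g (P (n + 1) (2 * i + 1)))|
          ≤ (Cu * (h ^ γ * q ^ n)) * (Cg * (h ^ γ * q ^ n)) := by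
      intro i hi
      have hi' : i < 2 ^ n := Finset.mem_range.1 hi
      have m0 := hPmem (n + 1) (2 * i) (by rw [pow_succ']; omega)
      have m1 := hPmem (n + 1) (2 * i + 1) (by rw [pow_succ']; omega)
      have m2 := hPmem (n + 1) (2 * i + 2) (by rw [pow_succ']; omega)
      have hd : 0 ≤ h / 2 ^ (n + 1) := by positivity
      have d0 : |P (n + 1) (2 * i) - P (n + 1) (2 * i + 1)| = h / 2 ^ (n + 1) := by
        rw [abs_sub_comm, hPsucc, abs_of_nonneg hd]
      have d1 : |P (n + 1) (2 * i + 2) - P (n + 1) (2 * i + 1)| = h / 2 ^ (n + 1) := by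
        rw [hPsucc, abs_of_nonneg hd]
      have hle : (h / 2 ^ (n + 1)) ^ γ ≤ h ^ γ * q ^ n := by
        rw [div_two_pow_rpow hh0, ← hq]
        gcongr ?_ * ?_
        exact pow_le_pow_of_le_one hq0.le hq1 (Nat.le_succ n)
      have b0 := hu _ m0 _ m1
      have b1 := hg _ m2 _ m1
      rw [d0] at b0
      rw [d1] at b1
      rw [abs_mul]
      exact mul_le_mul (b0.trans (by gcongr)) (b1.trans (by gcongr)) (abs_nonneg _) (by positivity)
    refine (Finset.sum_le_sum hterm).trans_eq ?_
    rw [Finset.sum_const, Finset.card_range, nsmul_eq_mul, mul_pow]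
    push_cast
    ring
  have key := dist_le_of_le_geometric_of_tendsto₀ (2 * q ^ 2) _ hr hdist hlim
  have hS0 : S 0 = u a * (g b - g a) := by
    simp only [hS, hP, hh]
    simp
  rw [hS0, dist_comm, Real.dist_eq] at key
  refine key.trans_eq ?_
  ring

/-! ### Pathwise Tanaka formula -/

/-- A continuous function without zeros on an interval has constant sign there. -/
lemma exists_sign_eq_of_ne_zero {Y : ℝ → ℝ} {a c : ℝ} (hac : a ≤ c)
    (hY : ContinuousOn Y (Icc a c)) (h0 : ∀ s ∈ Icc a c, Y s ≠ 0) :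
    ∃ e : ℝ, |e| = 1 ∧ ∀ s ∈ Icc a c, Real.sign (Y s) = e ∧ |Y s| = e * Y s := by
  have hsub : ∀ s ∈ Icc a c, Icc a s ⊆ Icc a c := fun s hs => Icc_subset_Icc_right hs.2
  rcases lt_or_gt_of_ne (h0 a ⟨le_rfl, hac⟩) with ha | ha
  · refine ⟨-1, by simp, fun s hs => ?_⟩
    have hneg : Y s < 0 := by
      by_contra! h
      obtain ⟨z, hz, hz0⟩ := intermediate_value_Icc hs.1 (hY.mono (hsub s hs)) ⟨ha.le, h⟩
      exact h0 z (hsub s hs hz) hz0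
    exact ⟨Real.sign_of_neg hneg, by rw [abs_of_neg hneg]; ring⟩
  · refine ⟨1, by simp, fun s hs => ?_⟩
    have hpos : 0 < Y s := by
      by_contra! h
      obtain ⟨z, hz, hz0⟩ := intermediate_value_Icc' hs.1 (hY.mono (hsub s hs)) ⟨h, ha.le⟩
      exact h0 z (hsub s hs hz) hz0
    exact ⟨Real.sign_of_pos hpos, by rw [abs_of_pos hpos]; ring⟩

lemma abs_sign_le_one (x : ℝ) : |Real.sign x| ≤ 1 := by
  rcases Real.sign_apply_eq x with h | h | h <;> simp [h]

lemma measurable_sign : Measurable Real.sign := by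
  unfold Real.sign
  exact Measurable.ite measurableSet_Iio measurable_const
    (Measurable.ite measurableSet_Ioi measurable_const measurable_const)

lemma continuousOn_of_abs_sub_le {f : ℝ → ℝ} {a b C γ : ℝ} (hγ : 0 < γ)
    (hf : ∀ s ∈ Icc a b, ∀ t ∈ Icc a b, |f s - f t| ≤ C * |s - t| ^ γ) :
    ContinuousOn f (Icc a b) := by
  intro t ht
  rw [ContinuousWithinAt, tendsto_iff_norm_sub_tendsto_zero]
  have hlim : Tendsto (fun s => C * |s - t| ^ γ) (𝓝[Icc a b] t) (𝓝 0) := by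
    have : Continuous fun s => C * |s - t| ^ γ :=
      continuous_const.mul ((by fun_prop : Continuous fun s : ℝ => |s - t|).rpow_const
        fun _ => Or.inr hγ.le)
    have h := this.tendsto t
    simp only [sub_self, abs_zero, Real.zero_rpow hγ.ne', mul_zero] at h
    exact h.mono_left nhdsWithin_le_nhds
  refine squeeze_zero' (Eventually.of_forall fun _ => norm_nonneg _) ?_ hlim
  filter_upwards [self_mem_nhdsWithin] with s hs using hf s hs t ht

/-- Pathwise Tanaka formula on `[0, T]`: `Y` is the sum of an absolutely continuous function and of
a Young integral `∫ u dg`, and spends so little time near zero that a negative power of `|Y|` is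
integrable. -/
theorem hasRSIntegral_sign_mul {Y d u g : ℝ → ℝ} {T γ C M : ℝ} (hT : 0 ≤ T)
    (hγ : 1 / 2 < γ) (hC : 0 < C) (hM : 0 ≤ M)
    (hY : ∀ s ∈ Icc 0 T, ∀ t ∈ Icc 0 T, |Y s - Y t| ≤ C * |s - t| ^ γ)
    (hu : ∀ s ∈ Icc 0 T, ∀ t ∈ Icc 0 T, |u s - u t| ≤ C * |s - t| ^ γ)
    (hg : ∀ s ∈ Icc 0 T, ∀ t ∈ Icc 0 T, |g s - g t| ≤ C * |s - t| ^ γ)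
    (huM : ∀ s ∈ Icc 0 T, |u s| ≤ M)
    (hd : IntervalIntegrable d volume 0 T)
    (hRS : ∀ t ∈ Icc 0 T, HasRSIntegral u g 0 t (Y t - Y 0 - ∫ s in (0 : ℝ)..t, d s))
    (hw : IntervalIntegrable (fun s => |Y s| ^ (-((1 - γ) / γ))) volume 0 T)
    (hY0 : ∀ᵐ s ∂volume.restrict (Ioc 0 T), Y s ≠ 0) (hγ1 : γ < 1) :
    IntervalIntegrable (fun s => Real.sign (Y s) * d s) volume 0 T ∧
    HasRSIntegral (fun s => Real.sign (Y s) * u s) g 0 T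
      (|Y T| - |Y 0| - ∫ s in (0 : ℝ)..T, Real.sign (Y s) * d s) := by
  have hγ0 : 0 < γ := by linarith
  have hYc : ContinuousOn Y (Icc 0 T) := continuousOn_of_abs_sub_le hγ0 hY
  have hYm : AEMeasurable Y (volume.restrict (Ioc 0 T)) :=
    (hYc.mono Ioc_subset_Icc_self).aemeasurable measurableSet_Ioc
  -- This exponent turns the bound |Y| ≤ C h^γ into |Y|^(-θ) ≥ C^(-θ) h^(γ - 1), whose integral over
  -- a cell of length h is of order h^γ.
  set θ : ℝ := (1 - γ) / γ with hθ
  have hθ0 : 0 < θ := div_pos (by linarith) hγ0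
  have hθγ : γ * θ = 1 - γ := by rw [hθ]; field_simp
  have hsd : IntervalIntegrable (fun s => Real.sign (Y s) * d s) volume 0 T := by
    rw [intervalIntegrable_iff_integrableOn_Ioc_of_le hT] at hd ⊢
    exact hd.bdd_mul (c := 1) (measurable_sign.comp_aemeasurable hYm).aestronglyMeasurable
      (Eventually.of_forall fun s => abs_sign_le_one _)
  refine ⟨hsd, hT, fun ε hε => ?_⟩
  have hmono : ∀ {f : ℝ → ℝ} {a c : ℝ}, IntervalIntegrable f volume 0 T → 0 ≤ a → a ≤ c → c ≤ T →
      IntervalIntegrable f volume a c := fun hf h0 hac hcT => hf.mono_set <| by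
    rw [uIcc_of_le hac, uIcc_of_le hT]; exact Icc_subset_Icc h0 hcT
  -- `K₁` is the Young-Love constant plus the cost C² of moving the tag to the left end point. In
  -- `K₂`, the 2 pays for |Y| at both end points, M for the term of the sum, and C^θ for the
  -- comparison with |Y|^(-θ).
  set K₁ : ℝ := C * C / (1 - 2 * ((2 : ℝ) ^ (-γ)) ^ 2) + C * C with hK₁
  set K₂ : ℝ := (2 + M) * C * C ^ θ with hK₂
  have hK₂0 : 0 ≤ K₂ := by positivity
  set Φ : ℝ → ℝ := fun s => K₂ * |Y s| ^ (-θ) + |d s| with hΦ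
  have hΦ0 : ∀ s, 0 ≤ Φ s := fun s => by positivity
  have hΦi : IntervalIntegrable Φ volume 0 T := (hw.const_mul K₂).add hd.abs
  set Ψ : ℝ → ℝ → ℝ := fun δ => indicator {s | |Y s| ≤ C * δ ^ γ} Φ with hΨ
  have hset : ∀ η : ℝ, NullMeasurableSet {s | |Y s| ≤ η} (volume.restrict (Ioc 0 T)) := fun η =>
    nullMeasurableSet_le hYm.abs aemeasurable_const
  have hΨ0 : ∀ δ s, 0 ≤ Ψ δ s := fun δ s => indicator_nonneg (fun s _ => hΦ0 s) s
  have hΨi : ∀ δ, IntervalIntegrable (Ψ δ) volume 0 T := fun δ => by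
    rw [intervalIntegrable_iff_integrableOn_Ioc_of_le hT] at hΦi ⊢
    exact Integrable.indicator₀ hΦi (hset _)
  -- error on one interval of the partition
  have hloc : ∀ δ > 0, ∀ a c ξ, 0 ≤ a → a ≤ c → c ≤ T → ξ ∈ Icc a c → c - a ≤ δ →
      |Real.sign (Y ξ) * u ξ * (g c - g a) -
        (|Y c| - |Y a| - ∫ s in a..c, Real.sign (Y s) * d s)|
        ≤ K₁ * δ ^ (2 * γ - 1) * (c - a) + ∫ s in a..c, Ψ δ s := by
    intro δ hδ a c ξ h0a hac hcT hξ hcδ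
    have hsub : Icc a c ⊆ Icc 0 T := Icc_subset_Icc h0a hcT
    have ha : a ∈ Icc a c := ⟨le_rfl, hac⟩
    have hc : c ∈ Icc a c := ⟨hac, le_rfl⟩
    have hh : 0 ≤ c - a := sub_nonneg.2 hac
    have habs : ∀ s ∈ Icc a c, ∀ t ∈ Icc a c, |s - t| ≤ c - a := fun s hs t ht =>
      abs_sub_le_iff.2 ⟨by linarith [hs.2, ht.1], by linarith [hs.1, ht.2]⟩
    have hosc : ∀ {f : ℝ → ℝ}, (∀ s ∈ Icc 0 T, ∀ t ∈ Icc 0 T, |f s - f t| ≤ C * |s - t| ^ γ) →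
        ∀ s ∈ Icc a c, ∀ t ∈ Icc a c, |f s - f t| ≤ C * (c - a) ^ γ := fun hf s hs t ht =>
      (hf s (hsub hs) t (hsub ht)).trans (by gcongr; exact habs s hs t ht)
    have hq0 : ∫ s in a..c, Ψ δ s ≥ 0 := intervalIntegral.integral_nonneg hac fun s _ => hΨ0 δ s
    have hK₁0 : 0 ≤ K₁ := by
      have hpos := sub_pos.2 (two_mul_two_rpow_neg_sq_lt_one hγ)
      positivity
    by_cases hgood : ∀ s ∈ Icc a c, Y s ≠ 0
    · obtain ⟨e, he, hsign⟩ := exists_sign_eq_of_ne_zero hac (hYc.mono hsub) hgood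
      have hint : ∫ s in a..c, Real.sign (Y s) * d s = e * ∫ s in a..c, d s := by
        rw [← intervalIntegral.integral_const_mul]
        refine intervalIntegral.integral_congr fun s hs => ?_
        rw [uIcc_of_le hac] at hs
        simp only [(hsign s hs).1]
      have hJ := (hRS a (hsub ha)).sub (hRS c (hsub hc)) hac
      have hY' := hJ.abs_sub_le_of_holder hγ hC.le hC.le
        (fun s hs t ht => hu s (hsub hs) t (hsub ht)) (fun s hs t ht => hg s (hsub hs) t (hsub ht))
      have hadd := intervalIntegral.integral_interval_sub_left (hmono hd le_rfl (hsub hc).1 hcT)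
        (hmono hd le_rfl h0a (hsub ha).2)
      rw [hint, (hsign ξ hξ).1, (hsign c hc).2, (hsign a ha).2]
      have e1 : e * u ξ * (g c - g a) - (e * Y c - e * Y a - e * ∫ s in a..c, d s)
          = e * ((u ξ - u a) * (g c - g a) - ((Y c - Y 0 - ∫ s in (0 : ℝ)..c, d s)
            - (Y a - Y 0 - ∫ s in (0 : ℝ)..a, d s) - u a * (g c - g a))) := by
        rw [← hadd]; ring
      rw [e1, abs_mul, he, one_mul]
      have h1 : |(u ξ - u a) * (g c - g a)| ≤ (C * (c - a) ^ γ) * (C * (c - a) ^ γ) := by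
        rw [abs_mul]
        exact mul_le_mul (hosc hu ξ hξ a ha) (hosc hg c hc a ha) (abs_nonneg _) (by positivity)
      have h2 := (abs_sub _ _).trans (add_le_add h1 hY')
      have h3 : ((c - a) ^ γ) ^ 2 ≤ δ ^ (2 * γ - 1) * (c - a) := by
        rcases hh.eq_or_lt with h | h
        · rw [← h, Real.zero_rpow hγ0.ne']; simp
        · have : ((c - a) ^ γ) ^ 2 = (c - a) ^ (2 * γ - 1) * (c - a) := by
            rw [← Real.rpow_natCast, ← Real.rpow_mul hh, ← Real.rpow_add_one h.ne']
            congr 1; push_cast; ring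
          rw [this]
          gcongr
          linarith
      calc _ ≤ _ := h2
        _ = K₁ * ((c - a) ^ γ) ^ 2 := by rw [hK₁]; ring
        _ ≤ K₁ * (δ ^ (2 * γ - 1) * (c - a)) := by gcongr
        _ ≤ _ := by linarith
    -- A zero in the cell leaves no cancellation to use: every term is bounded separately and
    -- charged to the integral of `Φ`, which agrees with `Ψ δ` on the cell.
    · push Not at hgood
      obtain ⟨z, hz, hz0⟩ := hgood
      have hsmall : ∀ s ∈ Icc a c, |Y s| ≤ C * (c - a) ^ γ := fun s hs => by
        have := hosc hY s hs z hz
        rwa [hz0, sub_zero] at this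
      have hΨeq : ∫ s in a..c, Ψ δ s = K₂ * (∫ s in a..c, |Y s| ^ (-θ)) + ∫ s in a..c, |d s| := by
        rw [← intervalIntegral.integral_const_mul, ← intervalIntegral.integral_add
          ((hmono hw h0a hac hcT).const_mul K₂) (hmono hd h0a hac hcT).abs]
        refine intervalIntegral.integral_congr fun s hs => ?_
        rw [uIcc_of_le hac] at hs
        refine indicator_of_mem (a := s) ?_ Φ
        exact (hsmall s hs).trans (by gcongr)
      have hwlow : (c - a) ^ γ ≤ C ^ θ * ∫ s in a..c, |Y s| ^ (-θ) := by
        rcases hh.eq_or_lt with h | h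
        · rw [← h, Real.zero_rpow hγ0.ne']
          have : c = a := by linarith
          simp [this]
        · have hconst : (c - a) ^ γ = ∫ _ in a..c, (c - a) ^ (γ - 1) := by
            rw [intervalIntegral.integral_const, smul_eq_mul, mul_comm, ← Real.rpow_add_one h.ne']
            simp
          rw [hconst, ← intervalIntegral.integral_const_mul]
          refine intervalIntegral.integral_mono_ae_restrict hac intervalIntegrable_const
            ((hmono hw h0a hac hcT).const_mul _) ?_
          -- Zeros of `Y` must be discarded: the real power 0^(-θ) is 0 in Lean, which would break
          -- the lower bound.
          have hne : ∀ᵐ s ∂volume.restrict (Icc a c), Y s ≠ 0 := by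
            rw [← restrict_Ioc_eq_restrict_Icc]
            exact ae_restrict_of_ae_restrict_of_subset (Ioc_subset_Ioc h0a hcT) hY0
          filter_upwards [hne, ae_restrict_mem measurableSet_Icc] with s hs hsI
          have hpow : (C * (c - a) ^ γ) ^ (-θ) ≤ |Y s| ^ (-θ) :=
            Real.rpow_le_rpow_of_nonpos (abs_pos.2 hs) (hsmall s hsI) (by linarith)
          have hval : (C * (c - a) ^ γ) ^ (-θ) = C ^ (-θ) * (c - a) ^ (γ - 1) := by
            rw [Real.mul_rpow hC.le (by positivity), ← Real.rpow_mul hh]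
            congr 2
            linarith
          calc (c - a) ^ (γ - 1) = C ^ θ * (C ^ (-θ) * (c - a) ^ (γ - 1)) := by
                rw [← mul_assoc, ← Real.rpow_add hC]; simp
            _ ≤ C ^ θ * |Y s| ^ (-θ) := by rw [← hval]; gcongr
      have hd' : |∫ s in a..c, Real.sign (Y s) * d s| ≤ ∫ s in a..c, |d s| := by
        refine (intervalIntegral.abs_integral_le_integral_abs hac).trans ?_
        refine intervalIntegral.integral_mono_on hac (hmono hsd h0a hac hcT).abs
          (hmono hd h0a hac hcT).abs fun s _ => ?_
        rw [abs_mul]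
        exact mul_le_of_le_one_left (abs_nonneg _) (abs_sign_le_one _)
      have h1 : |Real.sign (Y ξ) * u ξ * (g c - g a)| ≤ M * (C * (c - a) ^ γ) := by
        rw [abs_mul, abs_mul]
        refine mul_le_mul ?_ (hosc hg c hc a ha) (abs_nonneg _) hM
        exact (mul_le_of_le_one_left (abs_nonneg _) (abs_sign_le_one _)).trans (huM ξ (hsub hξ))
      have h2 := hsmall a ha
      have h3 := hsmall c hc
      have h4 : (2 + M) * C * (c - a) ^ γ ≤ K₂ * ∫ s in a..c, |Y s| ^ (-θ) := by
        rw [hK₂, mul_assoc _ (C ^ θ)]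
        gcongr
      have h5 : 0 ≤ K₁ * δ ^ (2 * γ - 1) * (c - a) := by positivity
      rw [hΨeq]
      have h6 := abs_nonneg (Y a)
      have h7 := abs_nonneg (Y c)
      rw [abs_le] at h1 hd' ⊢
      constructor <;> linarith [h1.1, h1.2, hd'.1, hd'.2]
  -- the total error vanishes with the mesh
  have hlim : Tendsto (fun δ : ℝ => K₁ * δ ^ (2 * γ - 1) * T + ∫ s in (0 : ℝ)..T, Ψ δ s)
      (𝓝[>] 0) (𝓝 0) := by
    have hp1 : Tendsto (fun δ : ℝ => δ ^ (2 * γ - 1)) (𝓝[>] 0) (𝓝 0) := by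
      have := (Real.continuousAt_rpow_const 0 (2 * γ - 1) (Or.inr (by linarith))).tendsto
      rw [Real.zero_rpow (by linarith)] at this
      exact this.mono_left nhdsWithin_le_nhds
    have hp2 : Tendsto (fun δ : ℝ => C * δ ^ γ) (𝓝[>] 0) (𝓝 0) := by
      have := (Real.continuousAt_rpow_const 0 γ (Or.inr hγ0.le)).tendsto
      rw [Real.zero_rpow hγ0.ne'] at this
      simpa using (this.mono_left nhdsWithin_le_nhds).const_mul C
    have hI : Tendsto (fun δ : ℝ => ∫ s in (0 : ℝ)..T, Ψ δ s) (𝓝[>] 0)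
        (𝓝 (∫ _ in (0 : ℝ)..T, (0 : ℝ))) := by
      simp only [intervalIntegral.integral_of_le hT]
      refine tendsto_integral_filter_of_dominated_convergence Φ ?_ ?_ ?_ ?_
      · exact Eventually.of_forall fun δ =>
          ((intervalIntegrable_iff_integrableOn_Ioc_of_le hT).1 (hΨi δ)).aestronglyMeasurable
      · refine Eventually.of_forall fun δ => Eventually.of_forall fun s => ?_
        rw [Real.norm_of_nonneg (hΨ0 δ s)]
        exact indicator_le_self' (fun s _ => hΦ0 s) s
      · exact (intervalIntegrable_iff_integrableOn_Ioc_of_le hT).1 hΦi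
      -- A time with Y s ≠ 0 leaves the set {|Y| ≤ C δ^γ} as soon as C δ^γ < |Y s|.
      · filter_upwards [hY0] with s hs
        refine tendsto_const_nhds.congr' ?_
        filter_upwards [hp2.eventually (gt_mem_nhds (abs_pos.2 hs))] with δ hδ
        exact (indicator_of_notMem (a := s) (fun h => absurd hδ (not_lt.2 h)) Φ).symm
    simpa using ((hp1.const_mul K₁).mul_const T).add hI
  obtain ⟨δ, hδε, hδ⟩ := ((hlim.eventually (gt_mem_nhds hε)).and self_mem_nhdsWithin).exists
  refine ⟨δ, hδ, fun n t ξ ht0 htn ht => ?_⟩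
  have hstep : ∀ i < n, t i ≤ t (i + 1) := fun i hi => (ht i hi).1.1.trans (ht i hi).1.2
  have hge : ∀ i ≤ n, 0 ≤ t i := by
    intro i
    induction i with
    | zero => intro _; exact ht0.ge
    | succ k ih => intro hk; exact (ih (by omega)).trans (hstep k (by omega))
  -- Induction runs backwards from `t n`, since nothing is known of the sequence beyond `n`.
  have hle : ∀ j ≤ n, t (n - j) ≤ T := by
    intro j
    induction j with
    | zero => intro _; exact htn.le
    | succ k ih =>
      intro hk
      have h := hstep (n - (k + 1)) (by omega)
      rw [show n - (k + 1) + 1 = n - k by omega] at h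
      exact h.trans (ih (by omega))
  have hle' : ∀ i ≤ n, t i ≤ T := fun i hi => by
    have h := hle (n - i) (by omega)
    rwa [show n - (n - i) = i by omega] at h
  have hpart : ∀ {f : ℝ → ℝ}, IntervalIntegrable f volume 0 T →
      ∑ i ∈ Finset.range n, ∫ s in t i..t (i + 1), f s = ∫ s in (0 : ℝ)..T, f s := fun hf => by
    rw [intervalIntegral.sum_integral_adjacent_intervals fun k hk =>
      hmono hf (hge k hk.le) (hstep k hk) (hle' (k + 1) hk), ht0, htn]
  have htel : |Y T| - |Y 0| - ∫ s in (0 : ℝ)..T, Real.sign (Y s) * d s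
      = ∑ i ∈ Finset.range n,
        (|Y (t (i + 1))| - |Y (t i)| - ∫ s in t i..t (i + 1), Real.sign (Y s) * d s) := by
    rw [Finset.sum_sub_distrib, Finset.sum_range_sub (fun i => |Y (t i)|), hpart hsd, ht0, htn]
  rw [htel, ← Finset.sum_sub_distrib]
  calc _ ≤ _ := Finset.abs_sum_le_sum_abs _ _
    _ ≤ ∑ i ∈ Finset.range n,
        (K₁ * δ ^ (2 * γ - 1) * (t (i + 1) - t i) + ∫ s in t i..t (i + 1), Ψ δ s) :=
      Finset.sum_le_sum fun i hi => by
        have hi := Finset.mem_range.1 hi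
        exact hloc δ hδ _ _ _ (hge i hi.le) (hstep i hi) (hle' _ hi) (ht i hi).1 (ht i hi).2.le
    _ = K₁ * δ ^ (2 * γ - 1) * T + ∫ s in (0 : ℝ)..T, Ψ δ s := by
      rw [Finset.sum_add_distrib, ← Finset.mul_sum, Finset.sum_range_sub t, hpart (hΨi δ), ht0, htn,
        sub_zero]
    _ < ε := hδε

/-! ### Hölder continuity from dyadic increments -/

/-- Dyadic chaining on the unit interval. -/
lemma exists_holder_of_dyadic_unit {f : ℝ → ℝ} {γ K : ℝ} (hγ : 0 < γ)
    (hf : ContinuousOn f (Icc 0 1))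
    (hK : ∀ n k : ℕ, k < 2 ^ n →
      |f ((k + 1) / 2 ^ n) - f (k / 2 ^ n)| ≤ K * ((2 : ℝ) ^ (-γ)) ^ n) :
    ∃ C, ∀ s ∈ Icc (0 : ℝ) 1, ∀ t ∈ Icc (0 : ℝ) 1, |f s - f t| ≤ C * |s - t| ^ γ := by
  set r : ℝ := (2 : ℝ) ^ (-γ) with hr
  have hr0 : 0 < r := by positivity
  have hr1 : r < 1 := Real.rpow_lt_one_of_one_lt_of_neg (by norm_num) (by linarith)
  have hr1' : 0 < 1 - r := by linarith
  have hK0 : 0 ≤ K := by simpa using (abs_nonneg _).trans (hK 0 0 (by norm_num))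
  set A : ℝ → ℕ → ℝ := fun t n => (⌊2 ^ n * t⌋₊ : ℝ) / 2 ^ n with hA
  have hA_le : ∀ t, 0 ≤ t → ∀ n, A t n ≤ t := fun t ht n => by
    simp only [hA]
    rw [div_le_iff₀ (by positivity), mul_comm]
    exact Nat.floor_le (by positivity)
  have hA_gt : ∀ t n, t - (1 / 2) ^ n < A t n := fun t n => by
    have := Nat.lt_floor_add_one ((2 : ℝ) ^ n * t)
    simp only [hA]
    rw [lt_div_iff₀ (by positivity), sub_mul, ← mul_pow]
    norm_num
    linarith
  have hA_lim : ∀ t ∈ Icc (0 : ℝ) 1, Tendsto (fun n => f (A t n)) atTop (𝓝 (f t)) := by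
    intro t ht
    refine (hf t ht).tendsto.comp (tendsto_nhdsWithin_iff.2 ⟨?_, ?_⟩)
    · refine tendsto_of_tendsto_of_tendsto_of_le_of_le (g := fun n : ℕ => t - (1 / 2 : ℝ) ^ n)
        ?_ tendsto_const_nhds (fun n => (hA_gt t n).le) (hA_le t ht.1)
      simpa using (tendsto_pow_atTop_nhds_zero_of_lt_one (r := (1 / 2 : ℝ))
        (by norm_num) (by norm_num)).const_sub t
    · exact Eventually.of_forall fun n => ⟨by positivity, (hA_le t ht.1 n).trans ht.2⟩
  -- a jump by at most one dyadic cell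
  have hjump : ∀ n k l : ℕ, k ≤ l → l ≤ k + 1 → l ≤ 2 ^ n →
      |f (k / 2 ^ n) - f (l / 2 ^ n)| ≤ K * r ^ n := by
    intro n k l h1 h2 h3
    rcases h1.eq_or_lt with rfl | h
    · rw [sub_self, abs_zero]; positivity
    · obtain rfl : l = k + 1 := by omega
      rw [abs_sub_comm]
      push_cast
      exact hK n k (by omega)
  have hfloor_le : ∀ t ∈ Icc (0 : ℝ) 1, ∀ n, ⌊2 ^ n * t⌋₊ ≤ 2 ^ n := fun t ht n => by
    refine Nat.floor_le_of_le ?_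
    push_cast
    exact mul_le_of_le_one_right (by positivity) ht.2
  have hstep : ∀ t ∈ Icc (0 : ℝ) 1, ∀ n, dist (f (A t n)) (f (A t (n + 1))) ≤ K * r * r ^ n := by
    intro t ht n
    have e : A t n = ((2 * ⌊2 ^ n * t⌋₊ : ℕ) : ℝ) / 2 ^ (n + 1) := by
      simp only [hA]; push_cast; field_simp; ring
    have hfl : 2 * ⌊2 ^ n * t⌋₊ ≤ ⌊2 ^ (n + 1) * t⌋₊ := by
      refine Nat.le_floor ?_
      push_cast
      have := Nat.floor_le (a := (2 : ℝ) ^ n * t) (mul_nonneg (by positivity) ht.1)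
      rw [pow_succ]; linarith
    have hfl' : ⌊2 ^ (n + 1) * t⌋₊ ≤ 2 * ⌊2 ^ n * t⌋₊ + 1 := by
      refine Nat.lt_succ_iff.1 ((Nat.floor_lt (mul_nonneg (by positivity) ht.1)).2 ?_)
      have := Nat.lt_floor_add_one ((2 : ℝ) ^ n * t)
      push_cast
      rw [pow_succ]; linarith
    rw [Real.dist_eq, e, mul_assoc, ← pow_succ']
    exact hjump (n + 1) _ _ hfl hfl' (hfloor_le t ht (n + 1))
  have hchain : ∀ t ∈ Icc (0 : ℝ) 1, ∀ n, |f (A t n) - f t| ≤ K * r * r ^ n / (1 - r) :=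
    fun t ht n => dist_le_of_le_geometric_of_tendsto r _ hr1 (hstep t ht) (hA_lim t ht) n
  set D : ℝ := (K + 2 * (K * r / (1 - r))) / r with hD
  have hmain : ∀ s ∈ Icc (0 : ℝ) 1, ∀ t ∈ Icc (0 : ℝ) 1, s < t → |f s - f t| ≤ D * |s - t| ^ γ := by
    intro s hs t ht hst
    have hpos : 0 < t - s := sub_pos.2 hst
    -- At the level with 2^(-(n+1)) < t - s ≤ 2^(-n), the dyadic floors of s and t differ by at most
    -- one cell. The gap between n and n + 1 costs the factor 1 / r in `D`.
    obtain ⟨n, hn1, hn2⟩ := exists_nat_pow_near_of_lt_one hpos (by linarith [ht.2, hs.1])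
      (by norm_num : (0 : ℝ) < 1 / 2) (by norm_num)
    have hmul : 2 ^ n * t ≤ 2 ^ n * s + 1 := by
      have h := mul_le_mul_of_nonneg_left hn2 (by positivity : (0 : ℝ) ≤ 2 ^ n)
      rw [← mul_pow] at h
      norm_num at h
      linarith
    have h0 : |f (A s n) - f (A t n)| ≤ K * r ^ n := by
      refine hjump n _ _ (Nat.floor_mono (by gcongr)) ?_ (hfloor_le t ht n)
      rw [← Nat.floor_add_one (mul_nonneg (by positivity) hs.1)]
      exact Nat.floor_mono hmul
    have h1 := hchain s hs n
    have h2 := hchain t ht n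
    have hsum : |f s - f t| ≤ (K + 2 * (K * r / (1 - r))) * r ^ n := by
      have e : (K + 2 * (K * r / (1 - r))) * r ^ n
        = K * r ^ n + K * r * r ^ n / (1 - r) + K * r * r ^ n / (1 - r) := by ring
      rw [e]
      rw [abs_le] at *
      constructor <;> linarith
    have hrn : r ^ n = ((1 / 2 : ℝ) ^ (n + 1)) ^ γ / r := by
      have : ((1 / 2 : ℝ) ^ (n + 1)) ^ γ = r ^ (n + 1) := by
        have := div_two_pow_rpow (h := 1) (γ := γ) zero_le_one (n + 1)
        rwa [Real.one_rpow, one_mul, ← one_div_pow] at this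
      rw [this, pow_succ]
      field_simp
    have hrn' : r ^ n ≤ |s - t| ^ γ / r := by
      rw [hrn, abs_sub_comm, abs_of_pos hpos]
      gcongr
    have hc : 0 ≤ K + 2 * (K * r / (1 - r)) := by positivity
    calc _ ≤ _ := hsum
      _ ≤ (K + 2 * (K * r / (1 - r))) * (|s - t| ^ γ / r) := by gcongr
      _ = D * |s - t| ^ γ := by rw [hD]; ring
  refine ⟨D, fun s hs t ht => ?_⟩
  rcases lt_trichotomy s t with h | rfl | h
  · exact hmain s hs t ht h
  · simp [Real.zero_rpow hγ.ne']
  · rw [abs_sub_comm, abs_sub_comm s]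
    exact hmain t ht s hs h

/-- Dyadic chaining: a continuous function on `[0, T]` whose increments over dyadic cells of level
`n` are at most `K * 2 ^ (-γ * n)` is `γ`-Hölder. -/
lemma exists_holder_of_dyadic {g : ℝ → ℝ} {T γ K : ℝ} (hT : 0 < T) (hγ : 0 < γ)
    (hg : ContinuousOn g (Icc 0 T))
    (hK : ∀ n k : ℕ, k < 2 ^ n →
      |g (T * ((k + 1) / 2 ^ n)) - g (T * (k / 2 ^ n))| ≤ K * ((2 : ℝ) ^ (-γ)) ^ n) :
    ∃ C, ∀ s ∈ Icc (0 : ℝ) T, ∀ t ∈ Icc (0 : ℝ) T, |g s - g t| ≤ C * |s - t| ^ γ := by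
  have hmap : MapsTo (fun x => T * x) (Icc (0 : ℝ) 1) (Icc 0 T) := fun x hx =>
    ⟨mul_nonneg hT.le hx.1, mul_le_of_le_one_right hT.le hx.2⟩
  obtain ⟨C, hC⟩ := exists_holder_of_dyadic_unit (f := fun x => g (T * x)) hγ
    (hg.comp (by fun_prop) hmap) hK
  refine ⟨C / T ^ γ, fun s hs t ht => ?_⟩
  have hdiv : ∀ x ∈ Icc (0 : ℝ) T, x / T ∈ Icc (0 : ℝ) 1 := fun x hx =>
    ⟨div_nonneg hx.1 hT.le, div_le_one_of_le₀ hx.2 hT.le⟩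
  have h := hC _ (hdiv s hs) _ (hdiv t ht)
  simp only [mul_div_cancel₀ _ hT.ne'] at h
  rw [← sub_div, abs_div, abs_of_pos hT, Real.div_rpow (abs_nonneg _) hT.le] at h
  refine h.trans_eq ?_
  ring

/-! ### Hölder paths of fractional Brownian motion -/

/-- Moments of the increments of fractional Brownian motion. -/
lemma IsFractionalBrownianMotion.lintegral_increment_pow {Ω : Type*} [MeasurableSpace Ω]
    {μ : Measure Ω} [IsProbabilityMeasure μ] {H T : ℝ} {B : ℝ → Ω → ℝ} (hH : 0 < H)
    (hB : IsFractionalBrownianMotion μ H T B) {s t : ℝ} (hs : s ∈ Icc 0 T) (ht : t ∈ Icc 0 T)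
    (p : ℕ) :
    ∫⁻ ω, ‖B t ω - B s ω‖ₑ ^ p ∂μ
      = ENNReal.ofReal (|t - s| ^ H) ^ p * ∫⁻ x, ‖x‖ₑ ^ p ∂(gaussianReal 0 1) := by
  have hlaw : HasGaussianLaw (fun ω => B t ω - B s ω) μ :=
    hB.gaussian.hasGaussianLaw_fun_sub (s := ⟨t, ht⟩) (t := ⟨s, hs⟩)
  have hls : HasGaussianLaw (B s) μ := hB.gaussian.hasGaussianLaw_eval ⟨s, hs⟩
  have hlt : HasGaussianLaw (B t) μ := hB.gaussian.hasGaussianLaw_eval ⟨t, ht⟩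
  have hmean : ∫ ω, (B t ω - B s ω) ∂μ = 0 := by
    rw [integral_sub hlt.integrable hls.integrable, hB.centered t ht, hB.centered s hs, sub_zero]
  have hvar : Var[fun ω => B t ω - B s ω; μ] = (|t - s| ^ H) ^ 2 := by
    rw [variance_fun_sub hlt.memLp_two hls.memLp_two, ← covariance_self hlt.aemeasurable,
      ← covariance_self hls.aemeasurable, hB.covariance_eq t ht t ht, hB.covariance_eq s hs s hs,
      hB.covariance_eq t ht s hs, ← Real.rpow_natCast, ← Real.rpow_mul (abs_nonneg _),
      abs_sub_comm s t]
    simp only [sub_self, abs_zero, Real.zero_rpow (by linarith : (2 * H) ≠ 0)]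
    push_cast
    rw [mul_comm H 2]
    ring
  have hmap := hlaw.map_eq_gaussianReal
  rw [hmean, hvar] at hmap
  have hscale : gaussianReal 0 ((|t - s| ^ H) ^ 2).toNNReal
      = (gaussianReal 0 1).map (fun x => |t - s| ^ H * x) := by
    rw [gaussianReal_map_const_mul, mul_zero, mul_one]
    congr 1
    exact NNReal.eq (Real.coe_toNNReal _ (sq_nonneg _))
  have hm : Measurable fun x : ℝ => ‖x‖ₑ ^ p := by fun_prop
  rw [← lintegral_map' (f := fun x : ℝ => ‖x‖ₑ ^ p) hm.aemeasurable hlaw.aemeasurable, hmap,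
    hscale, lintegral_map hm (by fun_prop), ← lintegral_const_mul _ hm]
  refine lintegral_congr fun x => ?_
  rw [enorm_mul, mul_pow, Real.enorm_of_nonneg (by positivity)]

lemma lintegral_enorm_pow_gaussianReal_lt_top (p : ℕ) :
    ∫⁻ x, ‖x‖ₑ ^ p ∂(gaussianReal 0 1) < ∞ := by
  rcases Nat.eq_zero_or_pos p with rfl | hp
  · simp
  have h := lintegral_rpow_enorm_lt_top_of_eLpNorm_lt_top (p := p) (by positivity)
    (ENNReal.natCast_ne_top p) (memLp_id_gaussianReal' (μ := 0) (v := 1) p (by simp)).eLpNorm_lt_top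
  simpa using h

/-- The paths of fractional Brownian motion are Hölder continuous of every order `γ < H`. -/
theorem IsFractionalBrownianMotion.ae_exists_holder {Ω : Type*} [MeasurableSpace Ω]
    {μ : Measure Ω} [IsProbabilityMeasure μ] {H T γ : ℝ} {B : ℝ → Ω → ℝ} (hT : 0 < T)
    (hγ : 0 < γ) (hγH : γ < H) (hB : IsFractionalBrownianMotion μ H T B) :
    ∀ᵐ ω ∂μ, ∃ C, ∀ s ∈ Icc (0 : ℝ) T, ∀ t ∈ Icc (0 : ℝ) T,
      |B s ω - B t ω| ≤ C * |s - t| ^ γ := by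
  -- With p (H - γ) > 1, the expected sum of rescaled p-th powers at level n decays like ρ^n, where
  -- ρ = 2^(1 - p (H - γ)) < 1; hence the total over all levels is almost surely finite.
  obtain ⟨p, hp⟩ := exists_nat_gt (1 / (H - γ))
  have hp0 : 0 < (p : ℝ) := (one_div_pos.2 (by linarith)).trans hp
  have hp1 : p ≠ 0 := by rintro rfl; simp at hp0
  have hpH : 1 < p * (H - γ) := by rwa [div_lt_iff₀ (by linarith)] at hp
  set τ : ℕ → ℕ → ℝ := fun n k => T * (k / 2 ^ n) with hτ
  have hτmem : ∀ n k, k ≤ 2 ^ n → τ n k ∈ Icc 0 T := fun n k hk => by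
    have : (k : ℝ) ≤ 2 ^ n := by exact_mod_cast hk
    refine ⟨by positivity, mul_le_of_le_one_right hT.le (div_le_one_of_le₀ this (by positivity))⟩
  set a : ℝ := (2 : ℝ) ^ γ with ha
  have ha0 : 0 < a := by positivity
  set F : ℕ → Ω → ℝ≥0∞ := fun n ω => ∑ k ∈ Finset.range (2 ^ n),
    ENNReal.ofReal (a ^ n) ^ p * ‖B (τ n (k + 1)) ω - B (τ n k) ω‖ₑ ^ p with hF
  have hBm : ∀ t ∈ Icc 0 T, AEMeasurable (B t) μ := fun t ht =>
    (hB.gaussian.hasGaussianLaw_eval ⟨t, ht⟩).aemeasurable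
  have hterm_m : ∀ n, ∀ k ∈ Finset.range (2 ^ n), AEMeasurable
      (fun ω => ENNReal.ofReal (a ^ n) ^ p * ‖B (τ n (k + 1)) ω - B (τ n k) ω‖ₑ ^ p) μ := by
    intro n k hk
    have hk := Finset.mem_range.1 hk
    exact ((((hBm _ (hτmem n (k + 1) hk)).sub (hBm _ (hτmem n k hk.le))).enorm).pow_const p).const_mul _
  have hFm : ∀ n, AEMeasurable (F n) μ := fun n => Finset.aemeasurable_fun_sum _ (hterm_m n)
  set M := ∫⁻ x, ‖x‖ₑ ^ p ∂(gaussianReal 0 1) with hM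
  set ρ : ℝ := 2 * (a * (2 : ℝ) ^ (-H)) ^ p with hρ
  have hρ0 : 0 ≤ ρ := by positivity
  have hρ1 : ρ < 1 := by
    have : ρ = (2 : ℝ) ^ (1 + (γ - H) * p) := by
      rw [hρ, ha, ← Real.rpow_add two_pos, ← Real.rpow_natCast, ← Real.rpow_mul two_pos.le,
        Real.rpow_add two_pos, Real.rpow_one]
      ring_nf
    rw [this]
    exact Real.rpow_lt_one_of_one_lt_of_neg (by norm_num) (by linarith)
  have hFint : ∀ n, ∫⁻ ω, F n ω ∂μ = ENNReal.ofReal ρ ^ n * (ENNReal.ofReal (T ^ H) ^ p * M) := by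
    intro n
    simp only [hF]
    rw [lintegral_finsetSum' _ (hterm_m n)]
    have hone : ∀ k ∈ Finset.range (2 ^ n),
        ∫⁻ ω, ENNReal.ofReal (a ^ n) ^ p * ‖B (τ n (k + 1)) ω - B (τ n k) ω‖ₑ ^ p ∂μ
        = ENNReal.ofReal (((a * (2 : ℝ) ^ (-H)) ^ p) ^ n) * (ENNReal.ofReal (T ^ H) ^ p * M) := by
      intro k hk
      have hk := Finset.mem_range.1 hk
      rw [lintegral_const_mul' _ _ (by simp),
        hB.lintegral_increment_pow (hγ.trans hγH) (hτmem n k hk.le) (hτmem n (k + 1) hk)]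
      have hd : |τ n (k + 1) - τ n k| = T / 2 ^ n := by
        have : τ n (k + 1) - τ n k = T / 2 ^ n := by simp only [hτ]; push_cast; ring
        rw [this, abs_of_pos (by positivity)]
      rw [hd, div_two_pow_rpow hT.le, ← hM, ← mul_assoc, ← mul_assoc, ← mul_pow,
        ← ENNReal.ofReal_mul (by positivity), ← ENNReal.ofReal_pow (by positivity),
        ← ENNReal.ofReal_pow (by positivity), ← ENNReal.ofReal_mul (by positivity)]
      congr 2
      ring
    rw [Finset.sum_congr rfl hone, Finset.sum_const, Finset.card_range, nsmul_eq_mul, ← mul_assoc]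
    congr 1
    rw [← ENNReal.ofReal_natCast, ← ENNReal.ofReal_mul (by positivity),
      ← ENNReal.ofReal_pow hρ0, hρ, mul_pow 2]
    push_cast
    rfl
  have hfin : ∫⁻ ω, ∑' n, F n ω ∂μ ≠ ∞ := by
    rw [lintegral_tsum hFm]
    simp only [hFint]
    rw [ENNReal.tsum_mul_right, ENNReal.tsum_geometric]
    refine ENNReal.mul_ne_top ?_ (ENNReal.mul_ne_top (by simp)
      (lintegral_enorm_pow_gaussianReal_lt_top p).ne)
    rw [ENNReal.inv_ne_top]
    exact (tsub_pos_of_lt (ENNReal.ofReal_lt_one.2 hρ1)).ne'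
  filter_upwards [ae_lt_top' (AEMeasurable.tsum hFm) hfin, hB.continuous_paths]
    with ω hω hcont
  set S : ℝ := (∑' n, F n ω).toReal with hS
  have hS0 : 0 ≤ S := ENNReal.toReal_nonneg
  refine exists_holder_of_dyadic (K := S + 1) hT hγ hcont fun n k hk => ?_
  have hle : ENNReal.ofReal (a ^ n) ^ p * ‖B (τ n (k + 1)) ω - B (τ n k) ω‖ₑ ^ p ≤ ∑' n, F n ω :=
    (Finset.single_le_sum (f := fun k => ENNReal.ofReal (a ^ n) ^ p *
      ‖B (τ n (k + 1)) ω - B (τ n k) ω‖ₑ ^ p) (fun _ _ => zero_le) (Finset.mem_range.2 hk)).trans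
      (ENNReal.le_tsum n)
  have hreal := ENNReal.toReal_mono hω.ne hle
  rw [← mul_pow, ENNReal.toReal_pow, ENNReal.toReal_mul, ENNReal.toReal_ofReal (by positivity),
    toReal_enorm, Real.norm_eq_abs, ← hS] at hreal
  -- Using `S + 1` avoids taking a p-th root of `S`.
  have hSp : S ≤ (S + 1) ^ p :=
    (by linarith : S ≤ S + 1).trans (le_self_pow₀ (by linarith) hp1)
  have hroot := le_of_pow_le_pow_left₀ hp1 (by linarith) (hreal.trans hSp)
  have hinv : ((2 : ℝ) ^ (-γ)) ^ n = (a ^ n)⁻¹ := by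
    rw [Real.rpow_neg two_pos.le, inv_pow]
  rw [hinv, ← div_eq_mul_inv, le_div_iff₀ (by positivity), mul_comm]
  simp only [hτ] at hroot
  push_cast at hroot
  exact hroot

/-! ### Time spent near a level -/

/-- Bridges the two conventions for powers, which disagree at y = 0 for negative exponents: ∞ in
`ℝ≥0∞`, 0 in `ℝ`. -/
lemma enorm_rpow_eq_enorm_abs_rpow {y : ℝ} (hy : y ≠ 0) (θ : ℝ) : ‖y‖ₑ ^ θ = ‖|y| ^ θ‖ₑ := by
  rw [Real.enorm_of_nonneg (Real.rpow_nonneg (abs_nonneg y) θ), ← ofReal_norm,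
    Real.norm_eq_abs, ENNReal.ofReal_rpow_of_pos (abs_pos.2 hy)]

lemma lintegral_Icc_enorm_rpow_neg_lt_top {θ : ℝ} (hθ0 : 0 < θ) (hθ : θ < 1) (x : ℝ) :
    ∫⁻ y in Icc (x - 1) (x + 1), ‖y - x‖ₑ ^ (-θ) < ∞ := by
  have hint : IntervalIntegrable (fun y : ℝ => |y| ^ (-θ)) volume (-1) 1 := by
    have h01 : IntervalIntegrable (fun y : ℝ => |y| ^ (-θ)) volume 0 1 := by
      refine (intervalIntegral.intervalIntegrable_rpow' (a := 0) (b := 1) (r := -θ)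
        (by linarith)).congr fun y hy => ?_
      rw [uIoc_of_le zero_le_one] at hy
      simp only [abs_of_pos hy.1]
    have h10 := (IntervalIntegrable.iff_comp_neg (by simp)).1 h01
    simp only [abs_neg, neg_zero] at h10
    exact h10.symm.trans h01
  have hint' : IntegrableOn (fun y : ℝ => |y - x| ^ (-θ)) (Icc (x - 1) (x + 1)) := by
    have := hint.comp_sub_right x
    rw [intervalIntegrable_iff_integrableOn_Icc_of_le (by linarith)] at this
    rwa [neg_add_eq_sub, add_comm 1 x] at this
  have hfin := hint'.hasFiniteIntegral
  refine lt_of_le_of_lt (lintegral_mono_ae ?_) hfin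
  have hne : ∀ᵐ y : ℝ ∂volume.restrict (Icc (x - 1) (x + 1)), y ≠ x :=
    ae_restrict_of_ae (Measure.ae_ne volume x)
  filter_upwards [hne] with y hy
  exact (enorm_rpow_eq_enorm_abs_rpow (sub_ne_zero.2 hy) _).le

/-- Negative moments of order less than one of a random variable with bounded density. -/
lemma lintegral_enorm_sub_rpow_neg_withDensity_le {θ : ℝ} (hθ0 : 0 < θ) (x : ℝ) {q : ℝ → ℝ≥0∞}
    (hq : Measurable q) :
    ∫⁻ y, ‖y - x‖ₑ ^ (-θ) ∂(volume.withDensity q)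
      ≤ (⨆ y, q y) * (∫⁻ y in Icc (x - 1) (x + 1), ‖y - x‖ₑ ^ (-θ))
        + (volume.withDensity q) univ := by
  have hm : Measurable fun y : ℝ => ‖y - x‖ₑ ^ (-θ) := by fun_prop
  rw [← lintegral_add_compl _ (measurableSet_Icc (a := x - 1) (b := x + 1))]
  refine add_le_add ?_ ?_
  · rw [restrict_withDensity measurableSet_Icc, lintegral_withDensity_eq_lintegral_mul _ hq hm,
      ← lintegral_const_mul _ hm]
    exact lintegral_mono fun y => mul_le_mul_left (le_iSup q y) _
  · calc _ ≤ ∫⁻ _ in (Icc (x - 1) (x + 1))ᶜ, 1 ∂(volume.withDensity q) := by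
          refine setLIntegral_mono measurable_const fun y hy => ?_
          have h1 : (1 : ℝ) ≤ |y - x| := by
            by_contra! h
            rw [abs_lt] at h
            exact hy ⟨by linarith [h.1], by linarith [h.2]⟩
          refine ENNReal.rpow_le_one_of_one_le_of_neg ?_ (by linarith)
          rw [← Real.enorm_abs, Real.enorm_of_nonneg (abs_nonneg _)]
          exact ENNReal.one_le_ofReal.2 h1
      _ ≤ _ := by
          rw [setLIntegral_const, one_mul]
          exact measure_mono (subset_univ _)

/-- A continuous process with one-dimensional densities whose suprema are integrable in time spends
so little time near a level `x` that a negative power of its distance to `x` is integrable. -/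
theorem ae_lintegral_enorm_sub_rpow_neg_lt_top {Ω : Type*} [MeasurableSpace Ω] {μ : Measure Ω}
    [IsProbabilityMeasure μ] {T θ : ℝ} (hT : 0 < T) (hθ0 : 0 < θ) (hθ : θ < 1)
    {X : ℝ → Ω → ℝ} (hXm : ∀ t ∈ Icc (0 : ℝ) T, Measurable (X t))
    (hXc : ∀ᵐ ω ∂μ, ContinuousOn (fun t => X t ω) (Icc 0 T)) {p : ℝ → ℝ → ℝ≥0∞}
    (hp : ∀ t ∈ Ioc (0 : ℝ) T, Measurable (p t) ∧ μ.map (X t) = volume.withDensity (p t))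
    (hp_int : ∫⁻ t in Ioc 0 T, (⨆ y : ℝ, p t y) < ∞) (x : ℝ) :
    ∀ᵐ ω ∂μ, ∫⁻ t in Ioc 0 T, ‖X t ω - x‖ₑ ^ (-θ) < ∞ := by
  classical
  obtain ⟨N, hNsub, hNm, hN0⟩ := exists_measurable_superset_of_null (ae_iff.1 hXc)
  have hgood : ∀ ω ∉ N, ContinuousOn (fun t => X t ω) (Icc 0 T) := fun ω hω => by
    by_contra h
    exact hω (hNsub h)
  have hNae : ∀ᵐ ω ∂μ, ω ∉ N := measure_eq_zero_iff_ae_notMem.1 hN0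
  -- Fubini needs joint measurability. Setting the process to zero on the measurable null set `N`
  -- and freezing it outside [0, T] makes every path continuous, which suffices.
  set Z : ℝ → Ω → ℝ := fun t => indicator Nᶜ (X (projIcc 0 T hT.le t)) with hZ
  have hZm : ∀ t, Measurable (Z t) := fun t =>
    (hXm _ (projIcc 0 T hT.le t).2).indicator hNm.compl
  have hZc : ∀ ω, Continuous fun t => Z t ω := fun ω => by
    by_cases h : ω ∈ N
    · have e : (fun t => Z t ω) = fun _ => 0 := funext fun t => by simp [hZ, h]
      rw [e]
      exact continuous_const
    · have e : (fun t => Z t ω) = fun t => X (projIcc 0 T hT.le t) ω :=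
        funext fun t => by simp [hZ, h]
      rw [e]
      exact (hgood ω h).comp_continuous (continuous_subtype_val.comp continuous_projIcc)
        fun t => (projIcc 0 T hT.le t).2
  have hZX : ∀ ω ∉ N, ∀ t ∈ Icc (0 : ℝ) T, Z t ω = X t ω := fun ω hω t ht => by
    simp [hZ, hω, projIcc_of_mem hT.le ht]
  have hZu : Measurable (Function.uncurry Z) :=
    measurable_uncurry_of_continuous_of_measurable hZc hZm
  have hm : Measurable fun q : Ω × ℝ => ‖Z q.2 q.1 - x‖ₑ ^ (-θ) := by
    have : Measurable fun q : Ω × ℝ => Z q.2 q.1 := hZu.comp measurable_swap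
    fun_prop
  set κ := ∫⁻ y in Icc (x - 1) (x + 1), ‖y - x‖ₑ ^ (-θ) with hκ
  have hκfin : κ < ∞ := lintegral_Icc_enorm_rpow_neg_lt_top hθ0 hθ x
  have hfix : ∀ t ∈ Ioc 0 T, ∫⁻ ω, ‖Z t ω - x‖ₑ ^ (-θ) ∂μ ≤ (⨆ y, p t y) * κ + 1 := by
    intro t ht
    have hmt := hXm t (Ioc_subset_Icc_self ht)
    have e : ∫⁻ ω, ‖Z t ω - x‖ₑ ^ (-θ) ∂μ = ∫⁻ y, ‖y - x‖ₑ ^ (-θ) ∂(volume.withDensity (p t)) := by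
      rw [← (hp t ht).2, lintegral_map (by fun_prop) hmt]
      refine lintegral_congr_ae ?_
      filter_upwards [hNae] with ω hω
      rw [hZX ω hω t (Ioc_subset_Icc_self ht)]
    have hone : (volume.withDensity (p t)) univ = 1 := by
      rw [← (hp t ht).2, Measure.map_apply hmt MeasurableSet.univ]
      simp
    rw [e, ← hone]
    exact lintegral_enorm_sub_rpow_neg_withDensity_le hθ0 x (hp t ht).1
  have hfin : ∫⁻ ω, (∫⁻ t in Ioc 0 T, ‖Z t ω - x‖ₑ ^ (-θ)) ∂μ ≠ ∞ := by
    rw [lintegral_lintegral_swap hm.aemeasurable]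
    refine ne_of_lt ?_
    calc _ ≤ ∫⁻ t in Ioc 0 T, ((⨆ y, p t y) * κ + 1) :=
          setLIntegral_mono' measurableSet_Ioc hfix
      _ = (∫⁻ t in Ioc 0 T, (⨆ y, p t y)) * κ + volume (Ioc 0 T) := by
          rw [lintegral_add_right _ measurable_const, lintegral_mul_const' _ _ hκfin.ne]
          simp
      _ < ∞ := by
          rw [Real.volume_Ioc]
          exact ENNReal.add_lt_top.2 ⟨ENNReal.mul_lt_top hp_int hκfin, ENNReal.ofReal_lt_top⟩
  filter_upwards [ae_lt_top' hm.lintegral_prod_right'.aemeasurable hfin, hNae] with ω hω hωN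
  refine lt_of_eq_of_lt (setLIntegral_congr_fun measurableSet_Ioc fun t ht => ?_) hω
  simp only [hZX ω hωN t (Ioc_subset_Icc_self ht)]

/-! ### Tanaka formula for the equation -/

theorem theorem2 {Ω : Type*} [MeasurableSpace Ω] (μ : Measure Ω) [IsProbabilityMeasure μ]
    (H T : ℝ) (hH : 1 / 2 < H) (hH1 : H < 1) (hT : 0 < T)
    (B : ℝ → Ω → ℝ) (hB : IsFractionalBrownianMotion μ H T B)
    (b σ : ℝ → ℝ) (hb : Measurable b) (hσ : ∃ K : ℝ≥0, LipschitzWith K σ)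
    (x₀ : ℝ) (X : ℝ → Ω → ℝ) (hX : IsPathwiseSDESolution μ T B b σ x₀ X)
    (hHolder : ∀ γ : ℝ≥0, 0 < γ → (γ : ℝ) < H →
      ∀ᵐ ω ∂μ, ∃ C : ℝ≥0, HolderOnWith C γ (fun t => X t ω) (Icc 0 T))
    (p : ℝ → ℝ → ℝ≥0∞)
    (hp : ∀ t ∈ Ioc (0 : ℝ) T, Measurable (p t) ∧ μ.map (X t) = volume.withDensity (p t))
    (hp_meas : AEMeasurable (fun t => ⨆ y : ℝ, p t y) (volume.restrict (Ioc 0 T)))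
    (hp_int : ∫⁻ t in Ioc 0 T, (⨆ y : ℝ, p t y) < ∞) :
    ∀ x : ℝ, ∀ᵐ ω ∂μ, ∀ t ∈ Icc (0 : ℝ) T,
      IntervalIntegrable (fun s => Real.sign (X s ω - x) * b (X s ω)) volume 0 t ∧
      ∃ J : ℝ,
        HasRSIntegral (fun s => Real.sign (X s ω - x) * σ (X s ω)) (fun s => B s ω) 0 t J ∧
        |X t ω - x| = |X 0 ω - x|
          + (∫ s in (0 : ℝ)..t, Real.sign (X s ω - x) * b (X s ω)) + J := by
  intro x
  -- γ > 1/2 serves both the Young-Love estimate and θ < 1; γ < H gives Hölder paths.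
  obtain ⟨γ, hγ, hγH⟩ := exists_between hH
  have hγ0 : 0 < γ := by linarith
  have hγ1 : γ < 1 := by linarith
  have hθ0 : 0 < (1 - γ) / γ := div_pos (by linarith) hγ0
  have hθ1 : (1 - γ) / γ < 1 := by rw [div_lt_one hγ0]; linarith
  obtain ⟨K, hK⟩ := hσ
  have hXH : ∀ᵐ ω ∂μ, ∃ C, ∀ s ∈ Icc (0 : ℝ) T, ∀ t ∈ Icc (0 : ℝ) T,
      |X s ω - X t ω| ≤ C * |s - t| ^ γ := by
    filter_upwards [hHolder ⟨γ, hγ0.le⟩ (by exact_mod_cast hγ0) hγH] with ω ⟨C, hC⟩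
    exact ⟨C, fun s hs t ht => hC.dist_le hs ht⟩
  have hXc : ∀ᵐ ω ∂μ, ContinuousOn (fun t => X t ω) (Icc 0 T) := by
    filter_upwards [hXH] with ω ⟨C, hC⟩ using continuousOn_of_abs_sub_le hγ0 hC
  filter_upwards [hX.equation, hXH, hXc, hB.ae_exists_holder hT hγ0 hγH,
    ae_lintegral_enorm_sub_rpow_neg_lt_top hT hθ0 hθ1 hX.measurable hXc hp hp_int x]
    with ω heq ⟨CX, hCX⟩ hcont ⟨CB, hCB⟩ hocc
  have hσX : ContinuousOn (fun t => σ (X t ω)) (Icc 0 T) := hK.continuous.comp_continuousOn hcont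
  obtain ⟨M, hM⟩ := isCompact_Icc.exists_bound_of_continuousOn hσX
  have hzero : (0 : ℝ) ∈ Icc 0 T := ⟨le_rfl, hT.le⟩
  have hx₀ : X 0 ω = x₀ := by
    obtain ⟨-, J, hJ, hJX⟩ := heq 0 hzero
    -- Over [0, 0] the partition with no cells is admissible at every mesh and has sum 0.
    have hJ0 : J = 0 := by
      by_contra hne
      obtain ⟨δ, -, hδ⟩ := hJ.2 |J| (abs_pos.2 hne)
      simpa using hδ 0 (fun _ => 0) (fun _ => 0) rfl rfl (by simp)
    simpa [hJ0] using hJX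
  set C : ℝ := max (max |CX| (K * |CX|)) |CB| + 1 with hC
  have hC1 : |CX| ≤ C :=
    ((le_max_left _ _).trans (le_max_left _ _)).trans (le_add_of_nonneg_right zero_le_one)
  have hC2 : K * |CX| ≤ C :=
    ((le_max_right _ _).trans (le_max_left _ _)).trans (le_add_of_nonneg_right zero_le_one)
  have hC3 : |CB| ≤ C := (le_max_right _ _).trans (le_add_of_nonneg_right zero_le_one)
  have hC0 : 0 < C := by positivity
  have hpow : ∀ s t : ℝ, 0 ≤ |s - t| ^ γ := fun s t => by positivity
  have hXb : ∀ s ∈ Icc (0 : ℝ) T, ∀ t ∈ Icc (0 : ℝ) T, |X s ω - X t ω| ≤ |CX| * |s - t| ^ γ :=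
    fun s hs t ht => (hCX s hs t ht).trans (mul_le_mul_of_nonneg_right (le_abs_self _) (hpow s t))
  -- The exceptional null set is already fixed; the pathwise formula is now applied on [0, t] for
  -- each `t`.
  intro t ht
  have hsub : Icc 0 t ⊆ Icc 0 T := Icc_subset_Icc_right ht.2
  have hocc' : ∫⁻ s in Ioc 0 t, ‖X s ω - x‖ₑ ^ (-((1 - γ) / γ)) < ∞ :=
    (lintegral_mono_set (Ioc_subset_Ioc_right ht.2)).trans_lt hocc
  have hYm : AEMeasurable (fun s => X s ω - x) (volume.restrict (Ioc 0 t)) :=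
    (((hcont.mono hsub).mono Ioc_subset_Icc_self).aemeasurable measurableSet_Ioc).sub_const x
  -- The integrand is ∞ at a zero, so finiteness of its integral makes the zero set null.
  have hY0 : ∀ᵐ s ∂volume.restrict (Ioc 0 t), X s ω - x ≠ 0 := by
    filter_upwards [ae_lt_top' (hYm.enorm.pow_const _) hocc'.ne] with s hs h0
    rw [h0, enorm_zero, ENNReal.zero_rpow_of_neg (by linarith)] at hs
    exact lt_irrefl _ hs
  have hw : IntervalIntegrable (fun s => |X s ω - x| ^ (-((1 - γ) / γ))) volume 0 t := by
    rw [intervalIntegrable_iff_integrableOn_Ioc_of_le ht.1]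
    refine ⟨(hYm.abs.pow_const _).aestronglyMeasurable, lt_of_le_of_lt (le_of_eq ?_) hocc'⟩
    refine lintegral_congr_ae ?_
    filter_upwards [hY0] with s hs
    exact (enorm_rpow_eq_enorm_abs_rpow hs _).symm
  have hmain := hasRSIntegral_sign_mul (Y := fun s => X s ω - x) (d := fun s => b (X s ω))
    (u := fun s => σ (X s ω)) (g := fun s => B s ω) (M := M) ht.1 hγ hC0
    ((norm_nonneg _).trans (hM 0 hzero))
    (fun s hs r hr => by
      simp only [sub_sub_sub_cancel_right]
      exact (hXb s (hsub hs) r (hsub hr)).trans (mul_le_mul_of_nonneg_right hC1 (hpow s r)))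
    (fun s hs r hr => by
      have h := hK.dist_le_mul (X s ω) (X r ω)
      rw [Real.dist_eq, Real.dist_eq] at h
      calc _ ≤ _ := h
        _ ≤ K * (|CX| * |s - r| ^ γ) := by gcongr; exact hXb s (hsub hs) r (hsub hr)
        _ = K * |CX| * |s - r| ^ γ := by ring
        _ ≤ _ := mul_le_mul_of_nonneg_right hC2 (hpow s r))
    (fun s hs r hr => (hCB s (hsub hs) r (hsub hr)).trans
      (mul_le_mul_of_nonneg_right ((le_abs_self _).trans hC3) (hpow s r)))
    (fun s hs => hM s (hsub hs)) (heq t ht).1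
    (fun s hs => by
      obtain ⟨-, J, hJ, hJX⟩ := heq s (hsub hs)
      convert hJ using 1
      rw [hx₀]
      linarith)
    hw hY0 hγ1
  exact ⟨hmain.1, _, hmain.2, by ring⟩
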